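/- Let $\mathcal N$ be a finite set and let $p_{\mathrm{data}}$ be a fully mixed probability distribution on $\mathcal N$, i.e. $p_{\mathrm{data}}(x)>0$ for all $x\in\mathcal N$ and $\sum_{x\in\mathcal N}p_{\mathrm{data}}(x)=1$. Let $\sigma(s)=1/(1+e^{-s})$. For $\theta,\phi\in\mathbb R^{\mathcal N}$ let the generator and the discriminator have outputs $\mathbf F(\theta)=(\sigma(\theta_x))_{x\in\mathcal N}$ and $\mathbf G(\phi)=(\sigma(\phi_x))_{x\in\mathcal N}$, let $$V(F,G)=\sum_{x\in\mathcal N}p_{\mathrm{data}}(x)\log G_x+\sum_{x\in\mathcal N}F_x\log(1-G_x)$$ be the value of the vanilla GAN, and let $$L(F,G,\lambda)=V(F,G)+\lambda\Big(\sum_{x\in\mathcal N}F_x-1\Big),\qquad \lambda\in\mathbb R,$$ be the Lagrangian for the constraint $\sum_x F_x=1$. Consider the continuous-time gradient-descent-ascent (GDA) dynamics of $\min_{\theta}\max_{\phi,\lambda}L(\mathbf F(\theta),\mathbf G(\phi),\lambda)$, that is, for all $x\in\mathcal N$, $$\dot\theta_x=-\frac{\partial}{\partial\theta_x}L(\mathbf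 F(\theta),\mathbf G(\phi),\lambda),\qquad \dot\phi_x=\frac{\partial}{\partial\phi_x}L(\mathbf F(\theta),\mathbf G(\phi),\lambda),\qquad \dot\lambda=\frac{\partial}{\partial\lambda}L(\mathbf F(\theta),\mathbf G(\phi),\lambda).$$ Theorem. For every initialization $(\theta(0),\phi(0),\lambda(0))\in\mathbb R^{\mathcal N}\times\mathbb R^{\mathcal N}\times\mathbb R$, the GDA dynamics have a solution on $[0,\infty)$, and every such solution satisfies $$\big(\mathbf F(\theta(t)),\mathbf G(\phi(t))\big)\longrightarrow\big(p_{\mathrm{data}},\tfrac12\mathbf 1_{|\mathcal N|}\big)\qquad\text{as }t\to\infty.$$ -/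

import Mathlib

open Filter Topology

/-- The value `V(G, D)` of the vanilla GAN on a finite set `X` of data points, for a data
distribution `pData`, generator output `G` and discriminator output `D`. -/
noncomputable def ganValue {X : Type*} [Fintype X] (pData G D : X → ℝ) : ℝ :=
  ∑ x, pData x * Real.log (D x) + ∑ x, G x * Real.log (1 - D x)

/-- The Lagrangian `L(F, G, lam)`: the GAN value plus the multiplier term for the constraint that
the generator output sums to one. -/
noncomputable def ganLagrangian {X : Type*} [Fintype X] (pData F G : X → ℝ) (lam : ℝ) : ℝ :=
  ganValue pData F G + lam * (∑ x, F x - 1)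

/-- The output of a player with parameter vector `w`: coordinate `x` is the sigmoid of the
one-dimensional parameter `w x`. -/
noncomputable def sigmoidOutput {X : Type*} (w : X → ℝ) : X → ℝ :=
  fun x => Real.sigmoid (w x)

/-- The Lagrangian as a function of the parameters `θ` (generator), `φ` (discriminator) and of the
multiplier `lam`. -/
noncomputable def hiddenLagrangian {X : Type*} [Fintype X] (pData θ φ : X → ℝ) (lam : ℝ) : ℝ :=
  ganLagrangian pData (sigmoidOutput θ) (sigmoidOutput φ) lam

/-- The partial derivative of `h` at `w` in the coordinate `x`. -/
noncomputable def partialDeriv {X : Type*} [DecidableEq X] (h : (X → ℝ) → ℝ) (w : X → ℝ)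
    (x : X) : ℝ :=
  deriv (fun s : ℝ => h (Function.update w x s)) (w x)

/-- `(θ, φ, lam)` solves, on the time interval `[0, ∞)` and from the initialization
`(θ₀, φ₀, lam₀)`, the continuous-time gradient-descent-ascent equations of
`min_θ max_{φ, lam} hiddenLagrangian pData θ φ lam`. -/
structure IsGDATrajectory {X : Type*} [Fintype X] [DecidableEq X] (pData : X → ℝ)
    (θ₀ φ₀ : X → ℝ) (lam₀ : ℝ) (θ φ : ℝ → X → ℝ) (lam : ℝ → ℝ) : Prop where
  init_gen : θ 0 = θ₀
  init_disc : φ 0 = φ₀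
  init_mult : lam 0 = lam₀
  gen : ∀ t : ℝ, 0 ≤ t → ∀ x : X,
    HasDerivWithinAt (fun s => θ s x)
      (-partialDeriv (fun w => hiddenLagrangian pData w (φ t) (lam t)) (θ t) x) (Set.Ici 0) t
  disc : ∀ t : ℝ, 0 ≤ t → ∀ x : X,
    HasDerivWithinAt (fun s => φ s x)
      (partialDeriv (fun w => hiddenLagrangian pData (θ t) w (lam t)) (φ t) x) (Set.Ici 0) t
  mult : ∀ t : ℝ, 0 ≤ t →
    HasDerivWithinAt lam
      (deriv (fun l => hiddenLagrangian pData (θ t) (φ t) l) (lam t)) (Set.Ici 0) t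

section GANDynamics

open Set
open Real (sigmoid)

/-! Write f, g for the sigmoids of θ, φ, and p for `pData`. If all p < 1, `lyapunov` is bounded
below: its generator part cancels the factor f(1 - f) in the θ equation, and the quadratic term is
centred at the equilibrium multiplier log 2, so all terms in λ cancel. By `dissipation_le` it
decreases at rate at least p(1 - 2g)²/2 for each data point. Barbalat's lemma gives g → 1/2, hence φ
→ 0; applied again to φ, it gives φ̇ = p(1 - g) - fg → 0, which forces f → p.

If some p = 1, there is only one data point and the potential is unbounded below. Then λ is
nonincreasing and y = exp(-θ) satisfies ẏ = (1 - f)²(log(1 - g) + λ). Whether or not λ is bounded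
below, y converges, and a positive limit would drive λ to -∞ or y below 0. So f → 1, and the scalar
equation for φ gives g → 1/2.

Global existence rests on the linear growth of log(1 - g) in φ: after θ is shrunk by a small factor,
Picard–Lindelöf covers any prescribed [0, T] in one application. -/

/-! ### Calculus on a half-line: monotonicity, Barbalat, barriers. -/

theorem image_sub_le_of_hasDerivWithinAt_le {f f' : ℝ → ℝ}
    (hf : ∀ t, 0 ≤ t → HasDerivWithinAt f (f' t) (Ici 0) t) {a b C : ℝ} (ha : 0 ≤ a)
    (hab : a ≤ b) (hC : ∀ s ∈ Ioo a b, f' s ≤ C) : f b - f a ≤ C * (b - a) := by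
  have hd : ∀ s ∈ Ioo a b, HasDerivAt f (f' s) s := fun s hs =>
    (hf s (ha.trans hs.1.le)).hasDerivAt (Ici_mem_nhds (ha.trans_lt hs.1))
  refine (convex_Icc a b).image_sub_le_mul_sub_of_deriv_le (f := f) ?_ ?_ ?_ a
    (left_mem_Icc.2 hab) b (right_mem_Icc.2 hab) hab
  · exact fun s hs => ((hf s (ha.trans hs.1)).continuousWithinAt).mono
      (fun r hr => ha.trans hr.1)
  · rw [interior_Icc]
    exact fun s hs => (hd s hs).differentiableAt.differentiableWithinAt
  · rw [interior_Icc]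
    exact fun s hs => (hd s hs).deriv.le.trans (hC s hs)

theorem antitoneOn_Ici_of_hasDerivWithinAt_nonpos {f f' : ℝ → ℝ}
    (hf : ∀ t, 0 ≤ t → HasDerivWithinAt f (f' t) (Ici 0) t) {a : ℝ} (ha : 0 ≤ a)
    (hC : ∀ s, a ≤ s → f' s ≤ 0) : AntitoneOn f (Ici a) := by
  intro s hs t _ hst
  have := image_sub_le_of_hasDerivWithinAt_le hf (C := 0) (ha.trans hs) hst
    (fun r hr => hC r (le_trans hs hr.1.le))
  linarith

theorem abs_sub_le_of_hasDerivWithinAt {f f' : ℝ → ℝ}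
    (hf : ∀ t, 0 ≤ t → HasDerivWithinAt f (f' t) (Ici 0) t) {K : ℝ}
    (hK : ∀ t, 0 ≤ t → |f' t| ≤ K) {s t : ℝ} (hs : 0 ≤ s) (ht : 0 ≤ t) :
    |f t - f s| ≤ K * |t - s| := by
  simpa using (convex_Ici (0 : ℝ)).norm_image_sub_le_of_norm_hasDerivWithin_le
    (f := f) (f' := f') (C := K) hf hK hs ht

theorem exists_tendsto_of_antitoneOn {f : ℝ → ℝ} {a m : ℝ} (hf : AntitoneOn f (Ici a))
    (hm : ∀ t, a ≤ t → m ≤ f t) : ∃ l, Tendsto f atTop (𝓝 l) := by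
  have h1 : Antitone fun t => f (max t a) := fun s t hst =>
    hf (mem_Ici.2 (le_max_right _ _)) (mem_Ici.2 (le_max_right _ _)) (max_le_max_right a hst)
  have h2 : BddBelow (range fun t => f (max t a)) := by
    refine ⟨m, ?_⟩
    rintro _ ⟨t, rfl⟩
    exact hm _ (le_max_right _ _)
  refine ⟨_, (tendsto_atTop_ciInf h1 h2).congr' ?_⟩
  filter_upwards [eventually_ge_atTop a] with t ht
  rw [max_eq_left ht]

/-- One-sided form of Barbalat's lemma: a Lipschitz dissipation rate `D` of a convergent
function is eventually at most `ε`. -/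
theorem eventually_le_of_hasDerivWithinAt_le_neg {E E' D : ℝ → ℝ} {l K ε : ℝ}
    (hE : ∀ t, 0 ≤ t → HasDerivWithinAt E (E' t) (Ici 0) t)
    (hl : Tendsto E atTop (𝓝 l)) (hED : ∀ t, 0 ≤ t → E' t ≤ -D t)
    (hD : ∀ s t, 0 ≤ s → 0 ≤ t → |D t - D s| ≤ K * |t - s|) (hε : 0 < ε) :
    ∀ᶠ t in atTop, D t ≤ ε := by
  have hK : 0 ≤ K := by
    have := (abs_nonneg _).trans (hD 0 1 le_rfl zero_le_one)
    simpa using this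
  -- On a window of length h the rate D varies by at most ε/2, so D t > ε would cost E more than h *
  -- ε/2, which convergence of E rules out. Using K + 1 allows K = 0.
  set h := ε / (2 * (K + 1)) with hh
  have hh0 : 0 < h := by positivity
  have hKh : K * h ≤ ε / 2 := by
    have : (K + 1) * h = ε / 2 := by rw [hh]; field_simp
    nlinarith
  have hlim : Tendsto (fun t => E t - E (t + h)) atTop (𝓝 0) := by
    simpa using hl.sub (hl.comp (tendsto_atTop_add_const_right atTop h tendsto_id))
  filter_upwards [hlim.eventually (gt_mem_nhds (show 0 < h * (ε / 2) by positivity)),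
    eventually_ge_atTop 0] with t ht ht0
  have := image_sub_le_of_hasDerivWithinAt_le hE (C := -(D t - ε / 2)) ht0
    (le_add_of_nonneg_right hh0.le : t ≤ t + h) (fun s hs => by
      have h1 := hED s (ht0.trans hs.1.le)
      have h2 := (abs_le.1 (hD t s ht0 (ht0.trans hs.1.le))).1
      rw [abs_of_pos (sub_pos.2 hs.1)] at h2
      have h3 : K * (s - t) ≤ K * h := by
        apply mul_le_mul_of_nonneg_left _ hK
        linarith [hs.2]
      linarith)
  have h4 : (D t - ε / 2) * h ≤ h * (ε / 2) := by
    have : t + h - t = h := by ring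
    rw [this] at *
    linarith
  have h5 : D t - ε / 2 ≤ ε / 2 := le_of_mul_le_mul_right (by linarith) hh0
  linarith

/-- Barbalat's lemma: a Lipschitz derivative of a convergent function tends to zero. -/
theorem tendsto_zero_of_hasDerivWithinAt {f f' : ℝ → ℝ} {l K : ℝ}
    (hf : ∀ t, 0 ≤ t → HasDerivWithinAt f (f' t) (Ici 0) t)
    (hl : Tendsto f atTop (𝓝 l))
    (hL : ∀ s t, 0 ≤ s → 0 ≤ t → |f' t - f' s| ≤ K * |t - s|) :
    Tendsto f' atTop (𝓝 0) := by
  rw [Metric.tendsto_nhds]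
  intro ε hε
  have h1 := eventually_le_of_hasDerivWithinAt_le_neg (D := fun t => -f' t) hf hl
    (fun t _ => by simp) (fun s t hs ht => by
      rw [← abs_neg]; convert hL s t hs ht using 2; ring) (half_pos hε)
  have h2 := eventually_le_of_hasDerivWithinAt_le_neg (E := fun t => -f t)
    (E' := fun t => -f' t) (D := f') (fun t ht => (hf t ht).neg) hl.neg
    (fun t _ => le_rfl) hL (half_pos hε)
  filter_upwards [h1, h2] with t h1 h2
  rw [Real.dist_eq, sub_zero, abs_lt]
  constructor <;> linarith

/-- If `f` decreases at a rate at least `c` wherever it is at least `b`, then it is eventually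
at most `b`. -/
theorem eventually_le_of_hasDerivWithinAt_le_of_le {f f' : ℝ → ℝ} {a b c : ℝ}
    (hf : ∀ t, 0 ≤ t → HasDerivWithinAt f (f' t) (Ici 0) t) (ha : 0 ≤ a) (hc : 0 < c)
    (h : ∀ t, a ≤ t → b ≤ f t → f' t ≤ -c) : ∀ᶠ t in atTop, f t ≤ b := by
  obtain ⟨t₁, ht₁, hft⟩ : ∃ t, a ≤ t ∧ f t ≤ b := by
    by_contra! hcon
    have h0 : 0 ≤ (f a - b) / c := div_nonneg (by linarith [hcon a le_rfl]) hc.le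
    have h1 := image_sub_le_of_hasDerivWithinAt_le hf ha
      (le_add_of_nonneg_right h0 : a ≤ a + (f a - b) / c)
      (fun s hs => h s hs.1.le (hcon s hs.1.le).le)
    have h2 : -c * (a + (f a - b) / c - a) = -(f a - b) := by field_simp; ring
    have := hcon _ (le_add_of_nonneg_right h0 : a ≤ a + (f a - b) / c)
    linarith
  filter_upwards [eventually_ge_atTop t₁] with t ht
  refine image_le_of_deriv_right_lt_deriv_boundary (f := f) (f' := f') (a := t₁) (b := t)
    (B := fun _ => b) (B' := fun _ => 0) ?_ ?_ hft (fun x => hasDerivAt_const x b) ?_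
    (right_mem_Icc.2 ht)
  · exact fun s hs => ((hf s (ha.trans (ht₁.trans hs.1))).continuousWithinAt).mono
      (fun r hr => ha.trans (ht₁.trans hr.1))
  · exact fun s hs => (hf s (ha.trans (ht₁.trans hs.1))).mono
      (fun r hr => ha.trans (ht₁.trans (hs.1.trans hr)))
  · intro s hs hsb
    linarith [h s (ht₁.trans hs.1) hsb.ge]

/-! ### Gluing solutions of an ODE. -/

/-- Solutions of an autonomous equation on all intervals `[0, T]` glue to a solution on
`[0, ∞)`. -/
theorem exists_hasDerivWithinAt_Ici_of_forall_Icc {E : Type*} [NormedAddCommGroup E]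
    [NormedSpace ℝ E] {v : E → E} (hv : LocallyLipschitz v) {x₀ : E}
    (h : ∀ T : ℝ, 0 < T → ∃ α : ℝ → E, α 0 = x₀ ∧
      ∀ t ∈ Icc 0 T, HasDerivWithinAt α (v (α t)) (Icc 0 T) t) :
    ∃ α : ℝ → E, α 0 = x₀ ∧ ∀ t, 0 ≤ t → HasDerivWithinAt α (v (α t)) (Ici 0) t := by
  have h' : ∀ T : ℝ, ∃ α : ℝ → E, 0 < T → α 0 = x₀ ∧
      ∀ t ∈ Icc 0 T, HasDerivWithinAt α (v (α t)) (Icc 0 T) t := by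
    intro T
    by_cases hT : 0 < T
    · obtain ⟨α, hα⟩ := h T hT
      exact ⟨α, fun _ => hα⟩
    · exact ⟨fun _ => x₀, fun h => absurd h hT⟩
  choose A hA using h'
  have huniq : ∀ S T : ℝ, 0 < S → S ≤ T → EqOn (A S) (A T) (Icc 0 S) := by
    intro S T hS hST
    have hc : ∀ R, S ≤ R → ContinuousOn (A R) (Icc 0 S) := fun R hR s hs =>
      ((hA R (hS.trans_le hR)).2 s ⟨hs.1, hs.2.trans hR⟩).continuousWithinAt.mono
        (Icc_subset_Icc_right hR)
    -- Both arcs are compact, so the field has a single Lipschitz constant on their union and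
    -- uniqueness applies.
    obtain ⟨K, hK⟩ := LocallyLipschitzOn.exists_lipschitzOnWith_of_compact
      ((isCompact_Icc.image_of_continuousOn (hc S le_rfl)).union
        (isCompact_Icc.image_of_continuousOn (hc T hST))) hv.locallyLipschitzOn
    have hd : ∀ R, S ≤ R → ∀ t ∈ Ico 0 S, HasDerivWithinAt (A R) (v (A R t)) (Ici t) t :=
      fun R hR t ht => ((hA R (hS.trans_le hR)).2 t
        ⟨ht.1, ht.2.le.trans hR⟩).mono_of_mem_nhdsWithin
        (mem_of_superset (Icc_mem_nhdsGE (ht.2.trans_le hR)) (Icc_subset_Icc_left ht.1))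
    exact ODE_solution_unique_of_mem_Icc_right (v := fun _ => v) (fun _ _ => hK)
      (hc S le_rfl) (hd S le_rfl)
      (fun t ht => Or.inl (mem_image_of_mem _ (Ico_subset_Icc_self ht))) (hc T hST) (hd T hST)
      (fun t ht => Or.inr (mem_image_of_mem _ (Ico_subset_Icc_self ht)))
      ((hA S hS).1.trans (hA T (hS.trans_le hST)).1.symm)
  -- The horizon t + 1 keeps t away from the right end; near t this diagonal agrees with the single
  -- solution `A (t + 2)`.
  refine ⟨fun t => A (t + 1) t, (hA (0 + 1) (by norm_num)).1, fun t ht => ?_⟩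
  have heq : ∀ s, 0 ≤ s → s ≤ t + 1 → A (s + 1) s = A (t + 2) s := fun s hs hst =>
    huniq (s + 1) (t + 2) (by linarith) (by linarith) ⟨hs, by linarith⟩
  have h1 := (hA (t + 2) (by linarith)).2 t ⟨ht, by linarith⟩
  have h2 : HasDerivWithinAt (A (t + 2)) (v (A (t + 2) t)) (Ici 0) t :=
    h1.mono_of_mem_nhdsWithin (by
      rw [← Ici_inter_Iic]
      exact inter_mem_nhdsWithin _ (Iic_mem_nhds (by linarith)))
  rw [← heq t ht (by linarith)] at h2
  refine h2.congr_of_eventuallyEq ?_ (heq t ht (by linarith))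
  filter_upwards [inter_mem_nhdsWithin (Ici 0) (Iic_mem_nhds (show t < t + 1 by linarith))]
    with s hs
  exact heq s hs.1 hs.2

/-! ### Sigmoid estimates. -/

theorem one_sub_sigmoid_pos (s : ℝ) : 0 < 1 - sigmoid s := sub_pos.2 (Real.sigmoid_lt_one s)

theorem hasDerivAt_log_sigmoid (s : ℝ) :
    HasDerivAt (fun s => Real.log (sigmoid s)) (1 - sigmoid s) s := by
  have h := (Real.hasDerivAt_sigmoid s).log (Real.sigmoid_pos s).ne'
  rwa [mul_div_cancel_left₀ _ (Real.sigmoid_pos s).ne'] at h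

theorem hasDerivAt_log_one_sub_sigmoid (s : ℝ) :
    HasDerivAt (fun s => Real.log (1 - sigmoid s)) (-sigmoid s) s := by
  have h := ((Real.hasDerivAt_sigmoid s).const_sub 1).log (one_sub_sigmoid_pos s).ne'
  convert h using 1
  rw [← neg_mul, mul_div_cancel_right₀ _ (one_sub_sigmoid_pos s).ne']

theorem log_one_sub_sigmoid (s : ℝ) :
    Real.log (1 - sigmoid s) = -Real.log (1 + Real.exp s) := by
  rw [← Real.sigmoid_neg, Real.sigmoid_def, neg_neg, Real.log_inv]

theorem log_one_sub_sigmoid_neg (s : ℝ) : Real.log (1 - sigmoid s) < 0 :=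
  Real.log_neg (one_sub_sigmoid_pos s) (by linarith [Real.sigmoid_pos s])

theorem abs_log_one_sub_sigmoid_le (s : ℝ) : |Real.log (1 - sigmoid s)| ≤ 1 + |s| := by
  rw [abs_of_neg (log_one_sub_sigmoid_neg s), log_one_sub_sigmoid, neg_neg,
    Real.log_le_iff_le_exp (by positivity), Real.exp_add]
  have h1 : Real.exp s ≤ Real.exp |s| := Real.exp_le_exp.2 (le_abs_self s)
  have h2 : 1 ≤ Real.exp |s| := Real.one_le_exp (abs_nonneg s)
  have h3 : 2 ≤ Real.exp 1 := by linarith [Real.add_one_le_exp 1]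
  nlinarith

theorem abs_sigmoid_mul_one_sub_le (s : ℝ) : |sigmoid s * (1 - sigmoid s)| ≤ 1 := by
  rw [abs_of_pos (mul_pos (Real.sigmoid_pos s) (one_sub_sigmoid_pos s))]
  nlinarith [Real.sigmoid_pos s, one_sub_sigmoid_pos s]

theorem HasDerivWithinAt.real_sigmoid {f : ℝ → ℝ} {f' t : ℝ} {s : Set ℝ}
    (hf : HasDerivWithinAt f f' s t) : HasDerivWithinAt (fun t => sigmoid (f t))
      (sigmoid (f t) * (1 - sigmoid (f t)) * f') s t :=
  (Real.hasDerivAt_sigmoid (f t)).comp_hasDerivWithinAt t hf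

theorem HasDerivWithinAt.prod_fst {E F : Type*} [NormedAddCommGroup E] [NormedSpace ℝ E]
    [NormedAddCommGroup F] [NormedSpace ℝ F] {f : ℝ → E × F} {f' : E × F} {s : Set ℝ} {t : ℝ}
    (hf : HasDerivWithinAt f f' s t) : HasDerivWithinAt (fun t => (f t).1) f'.1 s t := by
  simpa using hf.hasFDerivWithinAt.fst.hasDerivWithinAt

theorem HasDerivWithinAt.prod_snd {E F : Type*} [NormedAddCommGroup E] [NormedSpace ℝ E]
    [NormedAddCommGroup F] [NormedSpace ℝ F] {f : ℝ → E × F} {f' : E × F} {s : Set ℝ} {t : ℝ}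
    (hf : HasDerivWithinAt f f' s t) : HasDerivWithinAt (fun t => (f t).2) f'.2 s t := by
  simpa using hf.hasFDerivWithinAt.snd.hasDerivWithinAt

/-! ### The gradient of the Lagrangian. -/

section Gradient

variable {X : Type*}

/-- The partial derivatives of a separable function. -/
theorem partialDeriv_sum [Fintype X] [DecidableEq X] {g : X → ℝ → ℝ} {w : X → ℝ} {x : X} {g' : ℝ}
    (hg : HasDerivAt (g x) g' (w x)) :
    partialDeriv (fun w => ∑ y, g y (w y)) w x = g' := by
  have h : ∀ y ∈ Finset.univ, HasDerivAt (fun s => g y (Function.update w x s y))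
      (if y = x then g' else 0) (w x) := by
    intro y _
    by_cases hy : y = x
    · subst hy
      simpa using hg
    · simpa [hy] using hasDerivAt_const (w x) (g y (w y))
  have h2 := HasDerivAt.fun_sum h
  rw [Finset.sum_ite_eq' Finset.univ x, if_pos (Finset.mem_univ x)] at h2
  exact h2.deriv

theorem hiddenLagrangian_eq [Fintype X] (pData θ φ : X → ℝ) (lam : ℝ) :
    hiddenLagrangian pData θ φ lam =
      ∑ x, (pData x * Real.log (sigmoid (φ x))
        + sigmoid (θ x) * Real.log (1 - sigmoid (φ x)) + lam * sigmoid (θ x)) - lam := by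
  simp only [hiddenLagrangian, ganLagrangian, ganValue, sigmoidOutput, Finset.sum_add_distrib,
    ← Finset.mul_sum]
  ring

theorem partialDeriv_sub_const [DecidableEq X] (h : (X → ℝ) → ℝ) (c : ℝ) (w : X → ℝ) (x : X) :
    partialDeriv (fun w => h w - c) w x = partialDeriv h w x := by
  simp only [partialDeriv, deriv_sub_const]

theorem partialDeriv_hiddenLagrangian_gen [Fintype X] [DecidableEq X] (pData θ φ : X → ℝ) (lam : ℝ) (x : X) :
    partialDeriv (fun w => hiddenLagrangian pData w φ lam) θ x =
      sigmoid (θ x) * (1 - sigmoid (θ x)) * (Real.log (1 - sigmoid (φ x)) + lam) := by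
  simp only [hiddenLagrangian_eq]
  rw [partialDeriv_sub_const]
  refine partialDeriv_sum (g := fun x s => pData x * Real.log (sigmoid (φ x))
        + sigmoid s * Real.log (1 - sigmoid (φ x)) + lam * sigmoid s) ?_
  have h := Real.hasDerivAt_sigmoid (θ x)
  refine (((h.mul_const (Real.log (1 - sigmoid (φ x)))).const_add
    (pData x * Real.log (sigmoid (φ x)))).fun_add (h.const_mul lam)).congr_deriv ?_
  ring

theorem partialDeriv_hiddenLagrangian_disc [Fintype X] [DecidableEq X] (pData θ φ : X → ℝ) (lam : ℝ) (x : X) :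
    partialDeriv (fun w => hiddenLagrangian pData θ w lam) φ x =
      pData x * (1 - sigmoid (φ x)) - sigmoid (θ x) * sigmoid (φ x) := by
  simp only [hiddenLagrangian_eq]
  rw [partialDeriv_sub_const]
  refine partialDeriv_sum (g := fun x s => pData x * Real.log (sigmoid s)
        + sigmoid (θ x) * Real.log (1 - sigmoid s) + lam * sigmoid (θ x)) ?_
  refine ((((hasDerivAt_log_sigmoid (φ x)).const_mul (pData x)).fun_add
    ((hasDerivAt_log_one_sub_sigmoid (φ x)).const_mul (sigmoid (θ x)))).add_const
      (lam * sigmoid (θ x))).congr_deriv ?_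
  ring

theorem deriv_hiddenLagrangian_mult [Fintype X] (pData θ φ : X → ℝ) (lam : ℝ) :
    deriv (fun l => hiddenLagrangian pData θ φ l) lam = ∑ x, sigmoid (θ x) - 1 := by
  simp only [hiddenLagrangian, ganLagrangian, sigmoidOutput]
  simp

end Gradient

/-! ### Global existence. -/

section Existence

variable {X : Type*} [Fintype X]

/-- The vector field of the gradient-descent-ascent dynamics in the coordinates
`(c • θ, φ, lam)`. -/
noncomputable def scaledGDAField (pData : X → ℝ) (c : ℝ) (z : (X → ℝ) × (X → ℝ) × ℝ) :
    (X → ℝ) × (X → ℝ) × ℝ :=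
  (fun x => -(c * (sigmoid (c⁻¹ * z.1 x) * (1 - sigmoid (c⁻¹ * z.1 x))
      * (Real.log (1 - sigmoid (z.2.1 x)) + z.2.2))),
    fun x => pData x * (1 - sigmoid (z.2.1 x)) - sigmoid (c⁻¹ * z.1 x) * sigmoid (z.2.1 x),
    ∑ x, sigmoid (c⁻¹ * z.1 x) - 1)

theorem contDiff_scaledGDAField (pData : X → ℝ) (c : ℝ) :
    ContDiff ℝ 1 (scaledGDAField pData c) := by
  have hs : ContDiff ℝ 1 sigmoid := contDiff_sigmoid.of_le le_top
  have hθ : ∀ x, ContDiff ℝ 1 fun z : (X → ℝ) × (X → ℝ) × ℝ => sigmoid (c⁻¹ * z.1 x) :=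
    fun x => hs.comp (by fun_prop)
  have hφ : ∀ x, ContDiff ℝ 1 fun z : (X → ℝ) × (X → ℝ) × ℝ => sigmoid (z.2.1 x) :=
    fun x => hs.comp (by fun_prop)
  have hl : ∀ x, ContDiff ℝ 1 fun z : (X → ℝ) × (X → ℝ) × ℝ =>
      Real.log (1 - sigmoid (z.2.1 x)) :=
    fun x => (contDiff_const.sub (hφ x)).log fun z => (one_sub_sigmoid_pos _).ne'
  refine ContDiff.prodMk ?_ (ContDiff.prodMk ?_ ?_)
  · exact contDiff_pi.2 fun x => (contDiff_const.mul
      (((hθ x).mul (contDiff_const.sub (hθ x))).mul ((hl x).add (by fun_prop)))).neg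
  · exact contDiff_pi.2 fun x => (contDiff_const.mul (contDiff_const.sub (hφ x))).sub
      ((hθ x).mul (hφ x))
  · exact (ContDiff.sum fun x _ => hθ x).sub contDiff_const

/-- Only the θ component is unbounded, and its prefactor c absorbs the linear growth. The bound does
not depend on c, so the radius of the ball can be fixed before c. -/
theorem norm_scaledGDAField_le {pData : X → ℝ} (hpos : ∀ x, 0 < pData x)
    (hle : ∀ x, pData x ≤ 1) {c : ℝ} (hc : 0 < c) {z : (X → ℝ) × (X → ℝ) × ℝ}
    (hz : c * (1 + ‖z.2.1‖ + |z.2.2|) ≤ 1) :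
    ‖scaledGDAField pData c z‖ ≤ Fintype.card X + 1 := by
  have hN : (0 : ℝ) ≤ Fintype.card X := Nat.cast_nonneg _
  refine max_le ?_ (max_le ?_ ?_)
  · refine (pi_norm_le_iff_of_nonneg (by positivity)).2 fun x => ?_
    simp only [scaledGDAField, norm_neg, norm_mul, Real.norm_eq_abs, abs_of_pos hc]
    have h1 := abs_sigmoid_mul_one_sub_le (c⁻¹ * z.1 x)
    rw [abs_mul] at h1
    have h2 : |Real.log (1 - sigmoid (z.2.1 x)) + z.2.2| ≤ 1 + ‖z.2.1‖ + |z.2.2| := by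
      have h3 := abs_add_le (Real.log (1 - sigmoid (z.2.1 x))) z.2.2
      have h4 := abs_log_one_sub_sigmoid_le (z.2.1 x)
      have h5 : |z.2.1 x| ≤ ‖z.2.1‖ := norm_le_pi_norm z.2.1 x
      linarith
    calc _ ≤ c * (1 * (1 + ‖z.2.1‖ + |z.2.2|)) := by gcongr
      _ ≤ _ := by linarith
  · refine (pi_norm_le_iff_of_nonneg (by positivity)).2 fun x => ?_
    simp only [scaledGDAField, Real.norm_eq_abs]
    rw [abs_le]
    have h1 := Real.sigmoid_pos (z.2.1 x)
    have h2 := one_sub_sigmoid_pos (z.2.1 x)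
    have h3 := Real.sigmoid_pos (c⁻¹ * z.1 x)
    have h4 := one_sub_sigmoid_pos (c⁻¹ * z.1 x)
    have h5 := hpos x
    have h6 := hle x
    constructor
    · nlinarith [mul_pos h5 h2]
    · nlinarith [mul_pos h3 h1]
  · simp only [scaledGDAField, Real.norm_eq_abs]
    have h0 : 0 ≤ ∑ x, sigmoid (c⁻¹ * z.1 x) :=
      Finset.sum_nonneg fun x _ => (Real.sigmoid_pos _).le
    have h1 : ∑ x, sigmoid (c⁻¹ * z.1 x) ≤ ∑ _x : X, (1 : ℝ) :=
      Finset.sum_le_sum fun x _ => (Real.sigmoid_lt_one _).le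
    simp only [Finset.sum_const, Finset.card_univ, nsmul_eq_mul, mul_one] at h1
    rw [abs_le]
    constructor <;> linarith

theorem exists_scaledGDAField_solution {pData : X → ℝ} (hpos : ∀ x, 0 < pData x)
    (hle : ∀ x, pData x ≤ 1) (θ₀ φ₀ : X → ℝ) (lam₀ : ℝ) {T : ℝ} (hT : 0 < T) :
    ∃ c : ℝ, 0 < c ∧ ∃ α : ℝ → (X → ℝ) × (X → ℝ) × ℝ, α 0 = (c • θ₀, φ₀, lam₀) ∧
      ∀ t ∈ Icc 0 T, HasDerivWithinAt α (scaledGDAField pData c (α t)) (Icc 0 T) t := by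
  set N : NNReal := Fintype.card X + 1 with hN
  -- At speed at most N, the solution travels at most a in time T; R bounds 1 + ‖φ‖ + |λ| on the
  -- ball of radius a, whence c = R⁻¹.
  set a : NNReal := N * ⟨T, hT.le⟩ with ha
  set R : ℝ := 1 + (‖φ₀‖ + a) + (|lam₀| + a) with hR
  have hR0 : 0 < R := by positivity
  refine ⟨R⁻¹, inv_pos.2 hR0, ?_⟩
  obtain ⟨K, hK⟩ := LocallyLipschitzOn.exists_lipschitzOnWith_of_compact
    (isCompact_closedBall (R⁻¹ • θ₀, φ₀, lam₀) (a : ℝ))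
    (contDiff_scaledGDAField pData R⁻¹).locallyLipschitz.locallyLipschitzOn
  have hPL : IsPicardLindelof (fun _ => scaledGDAField pData R⁻¹)
      (⟨0, left_mem_Icc.2 hT.le⟩ : Icc 0 T) (R⁻¹ • θ₀, φ₀, lam₀) a 0 N K := by
    refine IsPicardLindelof.of_time_independent (fun z hz => ?_) hK ?_
    · have hz2 : ‖z.2.1 - φ₀‖ ≤ a ∧ |z.2.2 - lam₀| ≤ a := by
        rw [mem_closedBall_iff_norm] at hz
        have h1 := (norm_snd_le _).trans hz
        exact ⟨(norm_fst_le _).trans h1, (norm_snd_le _).trans h1⟩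
      have h := norm_scaledGDAField_le hpos hle (inv_pos.2 hR0) (z := z) ?_
      · simpa [hN] using h
      · rw [inv_mul_le_one₀ hR0, hR]
        have h1 := norm_le_norm_add_norm_sub' z.2.1 φ₀
        have h2 := norm_le_norm_add_norm_sub' z.2.2 lam₀
        rw [Real.norm_eq_abs, Real.norm_eq_abs, Real.norm_eq_abs] at h2
        linarith [hz2.1, hz2.2]
    · simp only [sub_zero, ha, NNReal.coe_zero]
      rw [max_eq_left (by simpa using hT.le)]
      rfl
  exact hPL.exists_eq_forall_mem_Icc_hasDerivWithinAt₀

theorem exists_isGDATrajectory [DecidableEq X] {pData : X → ℝ} (hpos : ∀ x, 0 < pData x)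
    (hle : ∀ x, pData x ≤ 1) (θ₀ φ₀ : X → ℝ) (lam₀ : ℝ) :
    ∃ (θ φ : ℝ → X → ℝ) (lam : ℝ → ℝ), IsGDATrajectory pData θ₀ φ₀ lam₀ θ φ lam := by
  obtain ⟨α, hα0, hα⟩ := exists_hasDerivWithinAt_Ici_of_forall_Icc
    (contDiff_scaledGDAField pData 1).locallyLipschitz (x₀ := (θ₀, φ₀, lam₀)) (by
      intro T hT
      obtain ⟨c, hc, α, hα0, hα⟩ := exists_scaledGDAField_solution hpos hle θ₀ φ₀ lam₀ hT
      refine ⟨fun t => (c⁻¹ • (α t).1, (α t).2), ?_, fun t ht => ?_⟩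
      · simp [hα0, smul_smul, hc.ne']
      · have h1 : HasDerivWithinAt (fun t => c⁻¹ • (α t).1) _ (Icc 0 T) t :=
          (hα t ht).prod_fst.const_smul c⁻¹
        refine (h1.prodMk (hα t ht).prod_snd).congr_deriv ?_
        ext x <;> simp [scaledGDAField, hc.ne'])
  refine ⟨fun t => (α t).1, fun t => (α t).2.1, fun t => (α t).2.2, by simp [hα0],
    by simp [hα0], by simp [hα0], fun t ht x => ?_, fun t ht x => ?_, fun t ht => ?_⟩
  · rw [partialDeriv_hiddenLagrangian_gen]
    simpa [scaledGDAField] using hasDerivWithinAt_pi.1 (hα t ht).prod_fst x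
  · rw [partialDeriv_hiddenLagrangian_disc]
    simpa [scaledGDAField] using hasDerivWithinAt_pi.1 (hα t ht).prod_snd.prod_fst x
  · rw [deriv_hiddenLagrangian_mult]
    simpa [scaledGDAField] using (hα t ht).prod_snd.prod_snd

end Existence

/-! ### The Lyapunov function and its dissipation. -/

theorem one_sub_sigmoid_mul_exp (s : ℝ) : (1 - sigmoid s) * Real.exp s = sigmoid s := by
  have h := Real.sigmoid_mul_rexp_neg (-s)
  rwa [neg_neg, Real.sigmoid_neg] at h

theorem sigmoid_mul_exp_neg (s : ℝ) : sigmoid s * Real.exp (-s) = 1 - sigmoid s := by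
  rw [Real.sigmoid_mul_rexp_neg, Real.sigmoid_neg]

theorem sinh_mul_sigmoid (s : ℝ) :
    Real.sinh s * (sigmoid s * (1 - sigmoid s)) = sigmoid s - 1 / 2 := by
  rw [Real.sinh_eq]
  linear_combination (sigmoid s / 2) * one_sub_sigmoid_mul_exp s
    - ((1 - sigmoid s) / 2) * sigmoid_mul_exp_neg s

theorem log_sigmoid_sub_log_one_sub_sigmoid (s : ℝ) :
    Real.log (sigmoid s) - Real.log (1 - sigmoid s) = s := by
  conv_lhs => rw [← one_sub_sigmoid_mul_exp s]
  rw [Real.log_mul (one_sub_sigmoid_pos s).ne' (Real.exp_pos s).ne', Real.log_exp]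
  rw [one_sub_sigmoid_mul_exp]
  ring

/-- The generator part of the Lyapunov function: an antiderivative of
`(sigmoid s - p) / (sigmoid s * (1 - sigmoid s))`. -/
noncomputable def genPotential (p s : ℝ) : ℝ :=
  (1 - 2 * p) * s + (1 - p) * Real.exp s + p * Real.exp (-s)

theorem hasDerivAt_genPotential (p s : ℝ) :
    HasDerivAt (genPotential p) ((1 - 2 * p) + (1 - p) * Real.exp s - p * Real.exp (-s)) s := by
  have h := (((hasDerivAt_id s).const_mul (1 - 2 * p)).fun_add
    ((Real.hasDerivAt_exp s).const_mul (1 - p))).fun_add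
    (((hasDerivAt_id s).neg.exp).const_mul p)
  refine h.congr_deriv ?_
  simp
  ring

theorem genPotential_deriv_mul (p s : ℝ) :
    ((1 - 2 * p) + (1 - p) * Real.exp s - p * Real.exp (-s)) *
      (sigmoid s * (1 - sigmoid s)) = sigmoid s - p := by
  linear_combination ((1 - p) * sigmoid s) * one_sub_sigmoid_mul_exp s
    - (p * (1 - sigmoid s)) * sigmoid_mul_exp_neg s

/-- The minimiser is the logit L of p; the tangent bound exp u ≥ u + 1 at u = ±(s - L) gives the
minimum. At p = 1 the potential is -s + exp(-s), with no lower bound. -/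
theorem exists_le_genPotential {p : ℝ} (h0 : 0 < p) (h1 : p < 1) :
    ∃ m, ∀ s, m ≤ genPotential p s := by
  have h1' : 0 < 1 - p := sub_pos.2 h1
  set L := Real.log (p / (1 - p))
  have hL : Real.exp L = p / (1 - p) := Real.exp_log (div_pos h0 h1')
  refine ⟨1 + (1 - 2 * p) * L, fun s => ?_⟩
  have e1 : (1 - p) * Real.exp s = p * Real.exp (s - L) := by
    rw [Real.exp_sub, hL]; field_simp
  have e2 : p * Real.exp (-s) = (1 - p) * Real.exp (-(s - L)) := by
    rw [show -(s - L) = -s + L by ring, Real.exp_add, hL]; field_simp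
  have i1 := Real.add_one_le_exp (s - L)
  have i2 := Real.add_one_le_exp (-(s - L))
  rw [genPotential, e1, e2]
  nlinarith [mul_le_mul_of_nonneg_left i1 h0.le, mul_le_mul_of_nonneg_left i2 h1'.le]

/-- The contribution of one data point to the derivative of the Lyapunov function. -/
theorem dissipation_le {p f s : ℝ} (hp : 0 ≤ p) (hf : 0 ≤ f) :
    -((f - p) * (Real.log (1 - sigmoid s) + Real.log 2))
      + Real.sinh s * (p * (1 - sigmoid s) - f * sigmoid s)
      ≤ -(p / 2 * (1 - 2 * sigmoid s) ^ 2) := by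
  have hg := Real.sigmoid_pos s
  have hg' := one_sub_sigmoid_pos s
  have hs := sinh_mul_sigmoid s
  set g := sigmoid s
  have hw : 0 < (1 - g) * 2 := by positivity
  -- The expression is affine in f and p. With w = 2(1 - g), the coefficient of f is nonpositive by
  -- log w ≥ 1 - 1/w, and that of p is handled by log w ≤ w - 1.
  rw [← Real.log_mul hg'.ne' two_ne_zero]
  have l1 := Real.log_le_sub_one_of_pos hw
  have l2 := Real.one_sub_inv_le_log_of_pos hw
  have s1 : Real.sinh s * g = ((1 - g) * 2)⁻¹ - 1 := by
    field_simp
    linear_combination 2 * hs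
  have s2 : Real.sinh s * (1 - g) = 1 - 1 / (2 * g) := by
    field_simp
    linear_combination 2 * hs
  have s3 : (1 - 2 * g) + (1 - 1 / (2 * g)) ≤ -((1 - 2 * g) ^ 2 / 2) := by
    have : (1 - 2 * g) + (1 - 1 / (2 * g)) + (1 - 2 * g) ^ 2 / 2
        = -((1 - 2 * g) ^ 2 * (1 - g) / (2 * g)) := by field_simp; ring
    have h2 : 0 ≤ (1 - 2 * g) ^ 2 * (1 - g) / (2 * g) := by positivity
    linarith
  have c1 := mul_le_mul_of_nonneg_left (show -Real.log ((1 - g) * 2) - Real.sinh s * g ≤ 0 by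
    linarith) hf
  have c2 := mul_le_mul_of_nonneg_left (show Real.log ((1 - g) * 2) + Real.sinh s * (1 - g)
    ≤ -((1 - 2 * g) ^ 2 / 2) by linarith) hp
  linarith

theorem sum_dissipation_le {X : Type*} [Fintype X] {pData : X → ℝ} (hpos : ∀ x, 0 < pData x) (u w : X → ℝ) (x : X) :
    ∑ x, (-((sigmoid (u x) - pData x) * (Real.log (1 - sigmoid (w x)) + Real.log 2))
        + Real.sinh (w x) * (pData x * (1 - sigmoid (w x)) - sigmoid (u x) * sigmoid (w x)))
      ≤ -(pData x / 2 * (1 - 2 * sigmoid (w x)) ^ 2) := by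
  have h1 := Finset.sum_le_sum fun x (_ : x ∈ Finset.univ) =>
    dissipation_le (s := w x) (hpos x).le (Real.sigmoid_pos (u x)).le
  refine h1.trans ?_
  rw [Finset.sum_neg_distrib, neg_le_neg_iff]
  exact Finset.single_le_sum (f := fun x => pData x / 2 * (1 - 2 * sigmoid (w x)) ^ 2)
    (fun y _ => by have := hpos y; positivity) (Finset.mem_univ x)

/-- The Lyapunov function of the dynamics. -/
noncomputable def lyapunov {X : Type*} [Fintype X] (pData θ φ : X → ℝ) (lam : ℝ) : ℝ :=
  ∑ x, (genPotential (pData x) (θ x) + Real.cosh (φ x)) + (lam - Real.log 2) ^ 2 / 2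

theorem abs_le_two_mul_cosh (s : ℝ) : |s| ≤ 2 * Real.cosh s := by
  rw [Real.cosh_eq]
  have h1 := Real.add_one_le_exp s
  have h2 := Real.add_one_le_exp (-s)
  have h3 := Real.exp_pos s
  have h4 := Real.exp_pos (-s)
  rw [abs_le]
  constructor <;> linarith

/-! ### Convergence when every probability is below one. -/

namespace IsGDATrajectory

variable {X : Type*} [Fintype X] [DecidableEq X] {pData θ₀ φ₀ : X → ℝ} {lam₀ : ℝ}
  {θ φ : ℝ → X → ℝ} {lam : ℝ → ℝ}

theorem hasDerivWithinAt_gen (h : IsGDATrajectory pData θ₀ φ₀ lam₀ θ φ lam) (x : X) (t : ℝ)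
    (ht : 0 ≤ t) : HasDerivWithinAt (fun s => θ s x)
      (-(sigmoid (θ t x) * (1 - sigmoid (θ t x)) *
        (Real.log (1 - sigmoid (φ t x)) + lam t))) (Ici 0) t := by
  rw [← partialDeriv_hiddenLagrangian_gen pData]
  exact h.gen t ht x

theorem hasDerivWithinAt_disc (h : IsGDATrajectory pData θ₀ φ₀ lam₀ θ φ lam) (x : X) (t : ℝ)
    (ht : 0 ≤ t) : HasDerivWithinAt (fun s => φ s x)
      (pData x * (1 - sigmoid (φ t x)) - sigmoid (θ t x) * sigmoid (φ t x)) (Ici 0) t := by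
  rw [← partialDeriv_hiddenLagrangian_disc pData (θ t) (φ t) (lam t)]
  exact h.disc t ht x

theorem hasDerivWithinAt_mult (h : IsGDATrajectory pData θ₀ φ₀ lam₀ θ φ lam) (t : ℝ)
    (ht : 0 ≤ t) : HasDerivWithinAt lam (∑ x, sigmoid (θ t x) - 1) (Ici 0) t := by
  rw [← deriv_hiddenLagrangian_mult pData (θ t) (φ t) (lam t)]
  exact h.mult t ht

theorem hasDerivWithinAt_lyapunov (h : IsGDATrajectory pData θ₀ φ₀ lam₀ θ φ lam)
    (hsum : ∑ x, pData x = 1) (t : ℝ) (ht : 0 ≤ t) :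
    HasDerivWithinAt (fun s => lyapunov pData (θ s) (φ s) (lam s))
      (∑ x, (-((sigmoid (θ t x) - pData x) * (Real.log (1 - sigmoid (φ t x)) + Real.log 2))
        + Real.sinh (φ t x) * (pData x * (1 - sigmoid (φ t x))
          - sigmoid (θ t x) * sigmoid (φ t x)))) (Ici 0) t := by
  have h1 : ∀ x ∈ Finset.univ, HasDerivWithinAt
      (fun s => genPotential (pData x) (θ s x) + Real.cosh (φ s x))
      (-((sigmoid (θ t x) - pData x) * (Real.log (1 - sigmoid (φ t x)) + lam t))
        + Real.sinh (φ t x) * (pData x * (1 - sigmoid (φ t x))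
          - sigmoid (θ t x) * sigmoid (φ t x))) (Ici 0) t := by
    intro x _
    refine (((hasDerivAt_genPotential (pData x) (θ t x)).comp_hasDerivWithinAt t
      (h.hasDerivWithinAt_gen x t ht)).fun_add
      ((Real.hasDerivAt_cosh (φ t x)).comp_hasDerivWithinAt t
      (h.hasDerivWithinAt_disc x t ht))).congr_deriv ?_
    rw [← genPotential_deriv_mul]
    ring
  have h2 := (((h.hasDerivWithinAt_mult t ht).sub_const (Real.log 2)).fun_pow 2).div_const 2
  refine ((HasDerivWithinAt.fun_sum h1).fun_add h2).congr_deriv ?_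
  -- Since p sums to one, the multiplier term is also a sum over f - p, and it replaces λ by log 2.
  have h3 : ∑ x, sigmoid (θ t x) - 1 = ∑ x, (sigmoid (θ t x) - pData x) := by
    rw [Finset.sum_sub_distrib, hsum]
  rw [h3, show ((2 : ℕ) : ℝ) * (lam t - Real.log 2) ^ (2 - 1)
    * (∑ x, (sigmoid (θ t x) - pData x)) / 2
    = ∑ x, (lam t - Real.log 2) * (sigmoid (θ t x) - pData x) by
      rw [← Finset.mul_sum]; norm_num; ring, ← Finset.sum_add_distrib]
  exact Finset.sum_congr rfl fun x _ => by ring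

theorem abs_disc_sub_le (h : IsGDATrajectory pData θ₀ φ₀ lam₀ θ φ lam)
    (hpos : ∀ x, 0 < pData x) (hle : ∀ x, pData x ≤ 1) (x : X) {s t : ℝ}
    (hs : 0 ≤ s) (ht : 0 ≤ t) : |sigmoid (φ t x) - sigmoid (φ s x)| ≤ |t - s| := by
  have := abs_sub_le_of_hasDerivWithinAt (K := 1)
    (fun r hr => (h.hasDerivWithinAt_disc x r hr).real_sigmoid) (fun r _ => ?_) hs ht
  · simpa using this
  · rw [abs_mul]
    refine mul_le_one₀ (abs_sigmoid_mul_one_sub_le _) (abs_nonneg _) ?_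
    have h1 := Real.sigmoid_pos (φ r x)
    have h2 := one_sub_sigmoid_pos (φ r x)
    have h3 := Real.sigmoid_pos (θ r x)
    have h4 := one_sub_sigmoid_pos (θ r x)
    have h5 := hpos x
    have h6 := hle x
    rw [abs_le]
    constructor
    · nlinarith [mul_pos h5 h2]
    · nlinarith [mul_pos h3 h1]

/-- The Lyapunov function is nonincreasing and its parts are bounded below, so cosh φ and (λ - log
2)² stay bounded. -/
theorem exists_bound (h : IsGDATrajectory pData θ₀ φ₀ lam₀ θ φ lam) (hpos : ∀ x, 0 < pData x)
    (hlt : ∀ x, pData x < 1) (hsum : ∑ x, pData x = 1) :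
    ∃ C : ℝ, ∀ t, 0 ≤ t → -C ≤ lyapunov pData (θ t) (φ t) (lam t) ∧ |lam t| ≤ C ∧
      ∀ x, |φ t x| ≤ C := by
  choose m hm using fun x => exists_le_genPotential (hpos x) (hlt x)
  obtain ⟨x₀, -⟩ : ∃ x : X, x ∈ Finset.univ := by
    by_contra! hc
    rw [Finset.sum_eq_zero fun x _ => absurd (Finset.mem_univ x) (hc x)] at hsum
    exact zero_ne_one hsum
  have hanti := antitoneOn_Ici_of_hasDerivWithinAt_nonpos
    (h.hasDerivWithinAt_lyapunov hsum) le_rfl (fun t _ =>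
      (sum_dissipation_le hpos (θ t) (φ t) x₀).trans
        (neg_nonpos.2 (by have := hpos x₀; positivity)))
  set H₀ := lyapunov pData (θ 0) (φ 0) (lam 0)
  have hlow : ∀ t, ∀ x, ∑ x, m x + Real.cosh (φ t x) + (lam t - Real.log 2) ^ 2 / 2
      ≤ lyapunov pData (θ t) (φ t) (lam t) := by
    intro t x
    rw [lyapunov, Finset.sum_add_distrib]
    have h1 := Finset.sum_le_sum fun x (_ : x ∈ Finset.univ) => hm x (θ t x)
    have h2 := Finset.single_le_sum (f := fun x => Real.cosh (φ t x))
      (fun y _ => (Real.cosh_pos _).le) (Finset.mem_univ x)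
    linarith
  have hup : ∀ t, 0 ≤ t → lyapunov pData (θ t) (φ t) (lam t) ≤ H₀ := fun t ht =>
    hanti (mem_Ici.2 le_rfl) ht ht
  refine ⟨2 * |H₀| + 2 * |∑ x, m x| + 1 + |Real.log 2|, fun t ht => ⟨?_, ?_, fun x => ?_⟩⟩
  · have h1 := hlow t x₀
    have h2 := Real.cosh_pos (φ t x₀)
    have h3 := neg_abs_le (∑ x, m x)
    linarith [sq_nonneg (lam t - Real.log 2), abs_nonneg H₀, abs_nonneg (∑ x, m x),
      abs_nonneg (Real.log 2)]
  · have h1 := hlow t x₀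
    have h2 := Real.cosh_pos (φ t x₀)
    have h3 := neg_abs_le (∑ x, m x)
    have h4 := (hup t ht).trans (le_abs_self _)
    have h5 : |lam t - Real.log 2| ≤ 1 + (lam t - Real.log 2) ^ 2 := by
      rw [← sq_abs]; nlinarith [sq_nonneg (|lam t - Real.log 2| - 1)]
    have h6 := abs_sub_abs_le_abs_sub (lam t) (Real.log 2)
    linarith
  · have h1 := hlow t x
    have h2 := abs_le_two_mul_cosh (φ t x)
    have h3 := neg_abs_le (∑ x, m x)
    have h4 := (hup t ht).trans (le_abs_self _)
    linarith [sq_nonneg (lam t - Real.log 2), abs_nonneg (Real.log 2)]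

theorem tendsto_disc_of_lt_one (h : IsGDATrajectory pData θ₀ φ₀ lam₀ θ φ lam)
    (hpos : ∀ x, 0 < pData x) (hlt : ∀ x, pData x < 1) (hsum : ∑ x, pData x = 1) (x : X) :
    Tendsto (fun t => sigmoid (φ t x)) atTop (𝓝 (1 / 2)) := by
  obtain ⟨C, hC⟩ := h.exists_bound hpos hlt hsum
  have hH := h.hasDerivWithinAt_lyapunov hsum
  have hp := hpos x
  obtain ⟨l, hl⟩ := exists_tendsto_of_antitoneOn
    (antitoneOn_Ici_of_hasDerivWithinAt_nonpos hH le_rfl (fun t _ =>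
      (sum_dissipation_le hpos (θ t) (φ t) x).trans (neg_nonpos.2 (by positivity))))
    (fun t ht => (hC t ht).1)
  have hD : ∀ s t, 0 ≤ s → 0 ≤ t → |pData x / 2 * (1 - 2 * sigmoid (φ t x)) ^ 2
      - pData x / 2 * (1 - 2 * sigmoid (φ s x)) ^ 2| ≤ 2 * |t - s| := by
    intro s t hs ht
    have h1 := h.abs_disc_sub_le hpos (fun x => (hlt x).le) x hs ht
    rw [show pData x / 2 * (1 - 2 * sigmoid (φ t x)) ^ 2
      - pData x / 2 * (1 - 2 * sigmoid (φ s x)) ^ 2 = 2 * ((pData x *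
        (sigmoid (φ t x) + sigmoid (φ s x) - 1)) * (sigmoid (φ t x) - sigmoid (φ s x))) by ring,
      abs_mul, abs_two, abs_mul]
    refine mul_le_mul_of_nonneg_left ?_ two_pos.le
    refine (mul_le_of_le_one_left (abs_nonneg _) ?_).trans h1
    rw [abs_mul, abs_of_pos hp]
    refine mul_le_one₀ (hlt x).le (abs_nonneg _) (abs_le.2 ⟨?_, ?_⟩)
    · linarith [Real.sigmoid_pos (φ t x), Real.sigmoid_pos (φ s x)]
    · linarith [Real.sigmoid_lt_one (φ t x), Real.sigmoid_lt_one (φ s x)]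
  rw [Metric.tendsto_nhds]
  intro ε hε
  filter_upwards [eventually_le_of_hasDerivWithinAt_le_neg hH hl
    (fun t _ => sum_dissipation_le hpos (θ t) (φ t) x) hD
    (show 0 < pData x * ε ^ 2 by positivity)] with t ht
  rw [Real.dist_eq]
  have h1 : (sigmoid (φ t x) - 1 / 2) ^ 2 < ε ^ 2 := by
    have : pData x * (2 * (sigmoid (φ t x) - 1 / 2) ^ 2) ≤ pData x * ε ^ 2 := by
      convert ht using 1; ring
    have := le_of_mul_le_mul_left this hp
    nlinarith [sq_nonneg (sigmoid (φ t x) - 1 / 2), pow_pos hε 2]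
  exact abs_lt_of_sq_lt_sq h1 hε.le

theorem tendsto_gen_of_lt_one (h : IsGDATrajectory pData θ₀ φ₀ lam₀ θ φ lam)
    (hpos : ∀ x, 0 < pData x) (hlt : ∀ x, pData x < 1) (hsum : ∑ x, pData x = 1) (x : X) :
    Tendsto (fun t => sigmoid (θ t x)) atTop (𝓝 (pData x)) := by
  obtain ⟨C, hC⟩ := h.exists_bound hpos hlt hsum
  have hG := h.tendsto_disc_of_lt_one hpos hlt hsum x
  have hφ : Tendsto (fun t => φ t x) atTop (𝓝 (Real.log (1 / 2) - Real.log (1 - 1 / 2))) := by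
    refine ((hG.log (by norm_num)).sub ((hG.const_sub 1).log (by norm_num))).congr fun t => ?_
    exact log_sigmoid_sub_log_one_sub_sigmoid _
  have hF : ∀ s t, 0 ≤ s → 0 ≤ t →
      |sigmoid (θ t x) - sigmoid (θ s x)| ≤ (1 + C + C) * |t - s| := by
    intro s t hs ht
    refine abs_sub_le_of_hasDerivWithinAt
      (fun r hr => (h.hasDerivWithinAt_gen x r hr).real_sigmoid) (fun r hr => ?_) hs ht
    obtain ⟨-, h1, h2⟩ := hC r hr
    have h3 := abs_log_one_sub_sigmoid_le (φ r x)
    have h4 := abs_sigmoid_mul_one_sub_le (θ r x)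
    have h5 := abs_add_le (Real.log (1 - sigmoid (φ r x))) (lam r)
    rw [abs_mul, abs_neg, abs_mul _ (Real.log (1 - sigmoid (φ r x)) + lam r)]
    refine (mul_le_of_le_one_left (by positivity) h4).trans
      ((mul_le_of_le_one_left (by positivity) h4).trans ?_)
    linarith [h2 x]
  have hd := tendsto_zero_of_hasDerivWithinAt (K := 3 + C + C) (h.hasDerivWithinAt_disc x) hφ
    (fun s t hs ht => by
      have h1 := h.abs_disc_sub_le hpos (fun x => (hlt x).le) x hs ht
      have h2 := hF s t hs ht
      have hp := hpos x
      -- The increment of φ̇ is split into the changes of g and of f; the constants 2 and 1 + C + C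
      -- add up to K.
      have a1 : |-(pData x + sigmoid (θ t x)) * (sigmoid (φ t x) - sigmoid (φ s x))|
          ≤ 2 * |t - s| := by
        rw [abs_mul, abs_neg, abs_of_pos (add_pos hp (Real.sigmoid_pos _))]
        exact mul_le_mul (by linarith [hlt x, Real.sigmoid_lt_one (θ t x)]) h1 (abs_nonneg _)
          two_pos.le
      have a2 : |sigmoid (φ s x) * (sigmoid (θ t x) - sigmoid (θ s x))|
          ≤ (1 + C + C) * |t - s| := by
        rw [abs_mul, abs_of_pos (Real.sigmoid_pos _)]
        exact (mul_le_of_le_one_left (abs_nonneg _) (Real.sigmoid_lt_one _).le).trans h2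
      have a3 := abs_sub (-(pData x + sigmoid (θ t x)) * (sigmoid (φ t x) - sigmoid (φ s x)))
        (sigmoid (φ s x) * (sigmoid (θ t x) - sigmoid (θ s x)))
      refine le_trans (le_of_eq ?_) (a3.trans ((add_le_add a1 a2).trans (le_of_eq ?_)))
      · congr 1; ring
      · ring)
  -- Solving the φ equation for f gives f = (p(1 - g) - φ̇)/g.
  have hlim := (((hG.const_sub 1).const_mul (pData x)).sub hd).div hG (by norm_num)
  convert hlim.congr fun t => ?_ using 2
  · norm_num
  · have := (Real.sigmoid_pos (φ t x)).ne'
    rw [Pi.div_apply]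
    field_simp
    ring

end IsGDATrajectory

/-! ### The case of a single data point. -/

/-- The dynamics on a single data point: the generator. -/
theorem tendsto_sigmoid_one_of_hasDerivWithinAt {θ φ lam : ℝ → ℝ}
    (hθ : ∀ t, 0 ≤ t → HasDerivWithinAt θ (-(sigmoid (θ t) * (1 - sigmoid (θ t)) *
        (Real.log (1 - sigmoid (φ t)) + lam t))) (Ici 0) t)
    (hlam : ∀ t, 0 ≤ t → HasDerivWithinAt lam (sigmoid (θ t) - 1) (Ici 0) t) :
    Tendsto (fun t => sigmoid (θ t)) atTop (𝓝 1) := by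
  have hy : ∀ t, 0 ≤ t → HasDerivWithinAt (fun s => Real.exp (-θ s))
      ((1 - sigmoid (θ t)) ^ 2 * (Real.log (1 - sigmoid (φ t)) + lam t)) (Ici 0) t := by
    intro t ht
    refine (hθ t ht).neg.exp.congr_deriv ?_
    simp only [Pi.neg_apply]
    linear_combination ((1 - sigmoid (θ t)) * (Real.log (1 - sigmoid (φ t)) + lam t))
      * sigmoid_mul_exp_neg (θ t)
  have hlam_anti : AntitoneOn lam (Ici 0) :=
    antitoneOn_Ici_of_hasDerivWithinAt_nonpos hlam le_rfl
      fun t _ => by linarith [Real.sigmoid_lt_one (θ t)]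
  have hF : ∀ Y, Tendsto (fun t => Real.exp (-θ t)) atTop (𝓝 Y) → 0 ≤ Y →
      Tendsto (fun t => sigmoid (θ t)) atTop (𝓝 (1 + Y)⁻¹) := fun Y hY hY0 =>
    (hY.const_add 1).inv₀ (by positivity)
  have hgap : ∀ Y, Tendsto (fun t => Real.exp (-θ t)) atTop (𝓝 Y) → 0 < Y →
      ∃ δ, 0 < δ ∧ ∃ a, 0 ≤ a ∧ ∀ t, a ≤ t → δ ≤ 1 - sigmoid (θ t) := by
    intro Y hY hY0
    have h1 : (1 + Y)⁻¹ < 1 := inv_lt_one_of_one_lt₀ (by linarith)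
    refine ⟨(1 - (1 + Y)⁻¹) / 2, by linarith, ?_⟩
    obtain ⟨a, ha⟩ := eventually_atTop.1 ((hF Y hY hY0.le).eventually
      (gt_mem_nhds (show (1 + Y)⁻¹ < (1 + (1 + Y)⁻¹) / 2 by linarith)))
    exact ⟨max a 0, le_max_right _ _, fun t ht => by
      linarith [ha t ((le_max_left _ _).trans ht)]⟩
  suffices hlim : Tendsto (fun t => Real.exp (-θ t)) atTop (𝓝 0) by
    simpa using hF 0 hlim le_rfl
  by_cases hb : ∃ m, ∀ t, 0 ≤ t → m ≤ lam t
  · obtain ⟨m, hm⟩ := hb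
    obtain ⟨l, hl⟩ := exists_tendsto_of_antitoneOn hlam_anti hm
    set c := |lam 0|
    have hc : 0 ≤ c := abs_nonneg _
    -- Since log(1 - g) < 0 and λ ≤ c, the growth of y is at most c(1 - f)² ≤ c(1 - f), the decay
    -- rate of cλ.
    have hW : AntitoneOn (fun t => Real.exp (-θ t) + c * lam t) (Ici 0) := by
      refine antitoneOn_Ici_of_hasDerivWithinAt_nonpos
        (fun t ht => (hy t ht).fun_add ((hlam t ht).const_mul c)) le_rfl fun t ht => ?_
      have h1 : lam t ≤ c := (hlam_anti (mem_Ici.2 le_rfl) ht ht).trans (le_abs_self _)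
      have h2 := log_one_sub_sigmoid_neg (φ t)
      have h3 := Real.sigmoid_pos (θ t)
      have h4 := one_sub_sigmoid_pos (θ t)
      have h5 : (1 - sigmoid (θ t)) ^ 2 * (Real.log (1 - sigmoid (φ t)) + lam t)
          ≤ (1 - sigmoid (θ t)) ^ 2 * c :=
        mul_le_mul_of_nonneg_left (by linarith) (sq_nonneg _)
      have h6 : (1 - sigmoid (θ t)) ^ 2 * c ≤ (1 - sigmoid (θ t)) * c :=
        mul_le_mul_of_nonneg_right (by nlinarith) hc
      linarith
    obtain ⟨w, hw⟩ := exists_tendsto_of_antitoneOn (m := c * m) hW fun t ht => by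
      have := mul_le_mul_of_nonneg_left (hm t ht) hc
      have := Real.exp_pos (-θ t)
      linarith
    have hY : Tendsto (fun t => Real.exp (-θ t)) atTop (𝓝 (w - c * l)) :=
      (hw.sub (hl.const_mul c)).congr fun t => by ring
    have hY0 : 0 ≤ w - c * l := ge_of_tendsto' hY fun t => (Real.exp_pos _).le
    rcases hY0.eq_or_lt with h0 | h0
    · rwa [h0]
    · obtain ⟨δ, hδ, a, ha, h1⟩ := hgap _ hY h0
      obtain ⟨t, ht, ht0⟩ := ((eventually_le_of_hasDerivWithinAt_le_of_le (b := m - 1) hlam ha hδ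
        fun t ht _ => by linarith [h1 t ht]).and (eventually_ge_atTop 0)).exists
      linarith [hm t ht0]
  · push Not at hb
    obtain ⟨t₁, ht₁, hlt₁⟩ := hb (-1)
    have hy' : ∀ t, t₁ ≤ t → (1 - sigmoid (θ t)) ^ 2 * (Real.log (1 - sigmoid (φ t)) + lam t)
        ≤ -(1 - sigmoid (θ t)) ^ 2 := fun t ht => by
      have h1 : lam t ≤ lam t₁ := hlam_anti ht₁ (ht₁.trans ht) ht
      have h2 := log_one_sub_sigmoid_neg (φ t)
      have := mul_le_mul_of_nonneg_left (show Real.log (1 - sigmoid (φ t)) + lam t ≤ -1 by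
        linarith) (sq_nonneg (1 - sigmoid (θ t)))
      linarith
    obtain ⟨Y, hY⟩ := exists_tendsto_of_antitoneOn (m := 0)
      (antitoneOn_Ici_of_hasDerivWithinAt_nonpos hy ht₁ fun t ht =>
        (hy' t ht).trans (neg_nonpos.2 (sq_nonneg _))) fun t _ => (Real.exp_pos _).le
    have hY0 : 0 ≤ Y := ge_of_tendsto' hY fun t => (Real.exp_pos _).le
    rcases hY0.eq_or_lt with h0 | h0
    · rwa [h0]
    · obtain ⟨δ, hδ, a, ha, h1⟩ := hgap _ hY h0
      obtain ⟨t, ht⟩ := (eventually_le_of_hasDerivWithinAt_le_of_le (a := max a t₁) (b := 0)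
        (c := δ ^ 2) hy (ha.trans (le_max_left _ _)) (by positivity) fun t ht _ => by
          refine (hy' t ((le_max_right _ _).trans ht)).trans (neg_le_neg ?_)
          exact pow_le_pow_left₀ hδ.le (h1 t ((le_max_left _ _).trans ht)) 2).exists
      exact absurd ht (not_le.2 (Real.exp_pos _))

/-- The dynamics on a single data point: the discriminator. -/
theorem tendsto_sigmoid_half_of_hasDerivWithinAt {θ φ : ℝ → ℝ}
    (hφ : ∀ t, 0 ≤ t → HasDerivWithinAt φ
      (1 - sigmoid (φ t) - sigmoid (θ t) * sigmoid (φ t)) (Ici 0) t)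
    (hθ : Tendsto (fun t => sigmoid (θ t)) atTop (𝓝 1)) :
    Tendsto (fun t => sigmoid (φ t)) atTop (𝓝 (1 / 2)) := by
  have h0 : Tendsto φ atTop (𝓝 0) := by
    rw [Metric.tendsto_nhds]
    intro ε hε
    set b := ε / 2
    have hb : 0 < b := half_pos hε
    have hg : 1 / 2 < sigmoid b := by
      have := Real.sigmoid_lt hb
      rw [Real.sigmoid_zero] at this
      linarith
    have hF : Tendsto (fun t => sigmoid b * (1 + sigmoid (θ t))) atTop
        (𝓝 (sigmoid b * (1 + 1))) := (hθ.const_add 1).const_mul _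
    obtain ⟨a, ha⟩ := eventually_atTop.1 (hF.eventually
      (lt_mem_nhds (show sigmoid b + 1 / 2 < sigmoid b * (1 + 1) by linarith)))
    have h1 := eventually_le_of_hasDerivWithinAt_le_of_le (a := max a 0) (b := b)
      (c := sigmoid b - 1 / 2) hφ (le_max_right _ _) (by linarith) fun t ht hbt => by
        have h2 := ha t ((le_max_left _ _).trans ht)
        have h3 := mul_le_mul_of_nonneg_right (Real.sigmoid_le hbt)
          (show 0 ≤ 1 + sigmoid (θ t) by linarith [Real.sigmoid_pos (θ t)])
        linarith
    -- From below, f < 1 suffices: φ̇ ≥ 1 - 2g, at least 2σ(b) - 1 once φ ≤ -b. Only the upper side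
    -- needs f → 1.
    have h2 := eventually_le_of_hasDerivWithinAt_le_of_le (f := fun t => -φ t) (a := 0) (b := b)
      (c := 2 * sigmoid b - 1) (fun t ht => (hφ t ht).neg) le_rfl (by linarith)
      fun t _ hbt => by
        have h2 := Real.sigmoid_le hbt
        rw [Real.sigmoid_neg] at h2
        have h3 := mul_le_mul_of_nonneg_right (Real.sigmoid_lt_one (θ t)).le
          (Real.sigmoid_pos (φ t)).le
        linarith
    filter_upwards [h1, h2] with t h1 h2
    rw [Real.dist_eq, sub_zero, abs_lt]
    have : b < ε := half_lt_self hε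
    constructor <;> linarith
  have := (continuous_sigmoid.tendsto 0).comp h0
  rwa [Real.sigmoid_zero, ← one_div] at this

/-! ### Combining the two cases. -/

theorem IsGDATrajectory.tendsto {X : Type*} [Fintype X] [DecidableEq X]
    {pData θ₀ φ₀ : X → ℝ} {lam₀ : ℝ} {θ φ : ℝ → X → ℝ} {lam : ℝ → ℝ}
    (h : IsGDATrajectory pData θ₀ φ₀ lam₀ θ φ lam)
    (hpos : ∀ x, 0 < pData x) (hsum : ∑ x, pData x = 1) (x : X) :
    Tendsto (fun t => sigmoid (θ t x)) atTop (𝓝 (pData x)) ∧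
      Tendsto (fun t => sigmoid (φ t x)) atTop (𝓝 (1 / 2)) := by
  by_cases hlt : ∀ x, pData x < 1
  · exact ⟨h.tendsto_gen_of_lt_one hpos hlt hsum x, h.tendsto_disc_of_lt_one hpos hlt hsum x⟩
  · push Not at hlt
    obtain ⟨z, hz⟩ := hlt
    have huniq : ∀ y, y = z := by
      intro y
      by_contra hy
      have h1 : ∑ x ∈ {y, z}, pData x ≤ ∑ x, pData x :=
        Finset.sum_le_sum_of_subset_of_nonneg (Finset.subset_univ _) fun x _ _ => (hpos x).le
      rw [Finset.sum_pair hy] at h1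
      linarith [hpos y]
    have hone : ∀ f : X → ℝ, ∑ y, f y = f x := fun f =>
      Fintype.sum_eq_single x fun y hy => absurd ((huniq y).trans (huniq x).symm) hy
    have hp : pData x = 1 := by rw [← hsum, hone]
    have hF : Tendsto (fun t => sigmoid (θ t x)) atTop (𝓝 1) :=
      tendsto_sigmoid_one_of_hasDerivWithinAt (h.hasDerivWithinAt_gen x) fun t ht => by
        have := h.hasDerivWithinAt_mult t ht
        rwa [hone] at this
    rw [hp]
    refine ⟨hF, tendsto_sigmoid_half_of_hasDerivWithinAt (fun t ht => ?_) hF⟩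
    have := h.hasDerivWithinAt_disc x t ht
    rwa [hp, one_mul] at this

end GANDynamics

theorem mainTheorem12 {X : Type*} [Fintype X] [DecidableEq X] (pData : X → ℝ)
    (hpos : ∀ x, 0 < pData x) (hsum : ∑ x, pData x = 1)
    (θ₀ φ₀ : X → ℝ) (lam₀ : ℝ) :
    (∃ (θ φ : ℝ → X → ℝ) (lam : ℝ → ℝ), IsGDATrajectory pData θ₀ φ₀ lam₀ θ φ lam) ∧
    ∀ (θ φ : ℝ → X → ℝ) (lam : ℝ → ℝ), IsGDATrajectory pData θ₀ φ₀ lam₀ θ φ lam →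
      Tendsto (fun t => (sigmoidOutput (θ t), sigmoidOutput (φ t))) atTop
        (𝓝 (pData, fun _ => 1 / 2)) := by
  have hle : ∀ x, pData x ≤ 1 := fun x => by
    rw [← hsum]
    exact Finset.single_le_sum (fun y _ => (hpos y).le) (Finset.mem_univ x)
  refine ⟨exists_isGDATrajectory hpos hle θ₀ φ₀ lam₀, fun θ φ lam h => ?_⟩
  exact (tendsto_pi_nhds.2 fun x => (h.tendsto hpos hsum x).1).prodMk_nhds
    (tendsto_pi_nhds.2 fun x => (h.tendsto hpos hsum x).2)
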